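/- All graphs are finite and simple. For a positive integer $r$, an $r$-matching of a graph $G$ is a set of $r$ pairwise vertex-disjoint edges of $G$. The matching Kneser graph $(G, rK_2)$ is the graph whose vertices are the $r$-matchings of $G$, two of them being adjacent whenever they have no edge in common. A graph is $rK_2$-free if it contains no $r$-matching, and $\mathrm{ex}(G, rK_2)$ denotes the maximum number of edges of an $rK_2$-free spanning subgraph of $G$. Theorem. For any positive integers $r$, $\Theta$ and $\Gamma$ such that $r \geq 3$ and $\Gamma \leq r-2$, there exists a connected bipartite graph $G$ for which $$\chi(G, rK_2) = \Theta \quad\text{and}\quad |E(G)| - \mathrm{ex}(G, rK_2) = \Theta + \Gamma .$$ -/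

import Mathlib

namespace MatchingKneser

/-- An `r`-matching of `G`: a matching of `G` with exactly `r` edges. The vertices of a subgraph
satisfying `IsMatching` are exactly the ends of its edges, so it is determined by its edge set. -/
abbrev RMatching {V : Type*} (G : SimpleGraph V) (r : ℕ) : Type _ :=
  {M : G.Subgraph // M.IsMatching ∧ M.edgeSet.encard = r}

/-- The matching Kneser graph `(G, rK₂)`: its vertices are the `r`-matchings of `G`, and two
distinct `r`-matchings are adjacent when they have no edge in common. (Distinctness is automatic
for `1 ≤ r`.) -/
def matchingKneserGraph {V : Type*} (G : SimpleGraph V) (r : ℕ) :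
    SimpleGraph (RMatching G r) where
  Adj M N := M ≠ N ∧ Disjoint M.1.edgeSet N.1.edgeSet
  symm := ⟨fun _ _ h => ⟨h.1.symm, h.2.symm⟩⟩
  loopless := ⟨fun _ h => h.1 rfl⟩

/-- A graph is `rK₂`-free if it contains no matching of size `r`. -/
def IsMatchingFree {V : Type*} (H : SimpleGraph V) (r : ℕ) : Prop :=
  IsEmpty (RMatching H r)

/-- The generalized Turán number `ex(G, rK₂)` of a finite graph `G` and `1 ≤ r`: the maximum
number of edges of an `rK₂`-free spanning subgraph of `G`. -/
noncomputable def exMatching {V : Type*} (G : SimpleGraph V) (r : ℕ) : ℕ :=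
  sSup {m : ℕ | ∃ H : SimpleGraph V, H ≤ G ∧ IsMatchingFree H r ∧ H.edgeSet.ncard = m}

end MatchingKneser

/-! With `k = Γ + 1` and `n = Θ + 2Γ`, the graph is a spider with `n` legs of length two, with `s =
r - k - 1` large stars attached to its centre by their hubs. The centre and the hubs cover every
edge except the outer edges of the legs, so an `r`-matching uses at least `k` outer edges. Matchings
thus inherit the standard colouring of the Kneser graph of `k`-subsets of the legs. Conversely, a
`k`-set `S` extends to an `r`-matching by one inner edge and one leaf edge per star, chosen so that
disjoint sets give disjoint matchings. Hence the chromatic number is that of the Kneser graph, `n -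
2k + 2 = Θ`. Destroying all `r`-matchings costs exactly `n - k + 1 = Θ + Γ` edges: fewer deletions
can neither empty a star nor remove both enough outer edges and an inner one.

The Kneser lower bound (`le_of_kneser_coloring`) follows Matoušek: a colouring gives an antipodal
labelling of sign vectors, and the Tucker–Fan lemma `exists_flag_nodup`, proved by parity counting,
bounds the number of label values from below. -/

namespace MatchingKneser

/-! ### Alternating sequences of signed labels -/

/-- A label is a natural number with a sign, ordered by the number first. -/
abbrev SignedLabel : Type := ℕ ×ₗ Bool

/-- The label with the same number and the opposite sign. -/
def SignedLabel.neg (a : SignedLabel) : SignedLabel := toLex ((ofLex a).1, !(ofLex a).2)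

/-- The indicator of the event that the signs of a list of labels alternate, starting with `s`. -/
def alternatingList : Bool → List SignedLabel → ZMod 2
  | _, [] => 1
  | s, a :: L => if (ofLex a).2 = s then alternatingList (!s) L else 0

/-- The indicator of the event that the signs of the labels in a multiset, sorted increasingly,
alternate and start with `s`. -/
def alternating (s : Bool) (M : Multiset SignedLabel) : ZMod 2 :=
  alternatingList s (M.sort (· ≤ ·))

theorem alternating_zero (s : Bool) : alternating s 0 = 1 := by
  simp [alternating, alternatingList]

theorem alternating_cons (s : Bool) (a : SignedLabel) (M : Multiset SignedLabel)
    (h : ∀ b ∈ M, a ≤ b) :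
    alternating s (a ::ₘ M) = if (ofLex a).2 = s then alternating (!s) M else 0 := by
  rw [alternating, Multiset.sort_cons _ _ _ h]
  rfl

/-- The parity count behind Ky Fan's lemma. If `M` alternates from `s`, only deleting the last label
leaves a sequence alternating from `s`; if it alternates from `!s`, only deleting the first does.
Any other `M` has zero or two such deletions. -/
theorem sum_alternating_erase (M : Multiset SignedLabel) (s : Bool) :
    (M.map fun a => alternating s (M.erase a)).sum = alternating s M + alternating (!s) M := by
  obtain ⟨L, hL, rfl⟩ : ∃ L : List SignedLabel, L.Pairwise (· ≤ ·) ∧ (L : Multiset _) = M :=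
    ⟨M.sort (· ≤ ·), M.pairwise_sort _, M.sort_eq _⟩
  induction L generalizing s with
  | nil =>
    simp only [Multiset.coe_nil, Multiset.map_zero, Multiset.sum_zero, alternating_zero]
    decide
  | cons a L ih =>
    rw [List.pairwise_cons] at hL
    have hmin : ∀ b ∈ (L : Multiset SignedLabel), a ≤ b := fun b hb => hL.1 b (by simpa using hb)
    have key : ((L : Multiset SignedLabel).map fun b =>
        alternating s ((a ::ₘ (L : Multiset SignedLabel)).erase b)) =
        (L : Multiset SignedLabel).map fun b =>
          (if (ofLex a).2 = s then 1 else 0) * alternating (!s) ((L : Multiset SignedLabel).erase b) := by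
      refine Multiset.map_congr rfl fun b hb => ?_
      rw [Multiset.erase_cons_tail_of_mem hb,
        alternating_cons _ _ _ fun d hd => hmin d (Multiset.mem_of_mem_erase hd)]
      split_ifs <;> simp
    rw [← Multiset.cons_coe, Multiset.map_cons, Multiset.sum_cons, Multiset.erase_cons_head, key,
      Multiset.sum_map_mul_left, ih (!s) hL.2, alternating_cons _ _ _ hmin,
      alternating_cons _ _ _ hmin, Bool.not_not]
    have h2 : ∀ x : ZMod 2, x + x = 0 := fun x => CharTwo.add_self_eq_zero x
    cases s <;> cases (ofLex a).2 <;> simp [← add_assoc]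
    all_goals rw [add_right_comm, h2, zero_add]

/-- Negation preserves the order of labels with different numbers. Excluding complementary pairs
excludes the only ties that it would reverse. -/
theorem alternating_map_neg (s : Bool) (M : Multiset SignedLabel)
    (h : ∀ a ∈ M, ∀ b ∈ M, b ≠ a.neg) :
    alternating s (M.map SignedLabel.neg) = alternating (!s) M := by
  have hsort : (M.sort (· ≤ ·)).map SignedLabel.neg = (M.map SignedLabel.neg).sort (· ≤ ·) := by
    refine Multiset.map_sort _ _ _ _ fun a ha b hb => ?_
    by_cases hab : (ofLex a).1 = (ofLex b).1
    · have : a = b := by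
        have := h a ha b hb
        rcases a with ⟨a, x⟩
        rcases b with ⟨b, y⟩
        replace hab : a = b := hab
        subst hab
        by_contra hne
        apply this
        have hxy : y = !x := by
          cases x <;> cases y <;> first | rfl | exact absurd rfl hne
        subst hxy
        rfl
      simp [this]
    · simp only [Prod.Lex.le_iff, SignedLabel.neg, ofLex_toLex]
      simp [hab]
  rw [alternating, ← hsort, alternating]
  generalize M.sort (· ≤ ·) = L
  induction L generalizing s with
  | nil => simp [alternatingList]
  | cons a L ih =>
    simp only [List.map_cons, alternatingList, ih, SignedLabel.neg, ofLex_toLex]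
    cases s <;> cases (ofLex a).2 <;> simp

/-- Two labels with the same number and opposite signs cannot both appear: then a sorted
alternating list has strictly increasing numbers. -/
theorem nodup_of_alternating {s : Bool} {M : Multiset SignedLabel} (hM : alternating s M ≠ 0)
    (h : ∀ a ∈ M, ∀ b ∈ M, b ≠ a.neg) : (M.map fun a => (ofLex a).1).Nodup := by
  obtain ⟨L, hL, rfl⟩ : ∃ L : List SignedLabel, L.Pairwise (· ≤ ·) ∧ (L : Multiset _) = M :=
    ⟨M.sort (· ≤ ·), M.pairwise_sort _, M.sort_eq _⟩
  induction L generalizing s with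
  | nil => simp
  | cons a L ih =>
    rw [List.pairwise_cons] at hL
    have hmin : ∀ b ∈ (L : Multiset SignedLabel), a ≤ b := fun b hb => hL.1 b (by simpa using hb)
    rw [← Multiset.cons_coe, alternating_cons _ _ _ hmin] at hM
    have hM' : alternating (!s) (L : Multiset SignedLabel) ≠ 0 := fun h0 => hM (by simp [h0])
    have hs : (ofLex a).2 = s := by
      by_contra h0
      exact hM (by simp [h0])
    have h' : ∀ a ∈ (L : Multiset SignedLabel), ∀ b ∈ (L : Multiset SignedLabel), b ≠ a.neg := by
      intro x hx y hy
      exact h x (by rw [← Multiset.cons_coe]; exact Multiset.mem_cons_of_mem hx) y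
        (by rw [← Multiset.cons_coe]; exact Multiset.mem_cons_of_mem hy)
    rw [← Multiset.cons_coe, Multiset.map_cons, Multiset.nodup_cons]
    refine ⟨?_, ih hL.2 hM' h'⟩
    -- Consecutive signs differ, so equal consecutive numbers would form a complementary pair.
    have hlt : ∀ b ∈ L, (ofLex a).1 < (ofLex b).1 := by
      cases L with
      | nil => simp
      | cons d L =>
        have hd : (ofLex d).2 = !s := by
          rw [← Multiset.cons_coe, alternating_cons] at hM'
          · by_contra h0
            exact hM' (by simp [h0])
          · intro b hb
            exact (List.pairwise_cons.1 hL.2).1 b (by simpa using hb)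
        have had : (ofLex a).1 < (ofLex d).1 := by
          have hle := hL.1 d (by simp)
          rw [Prod.Lex.le_iff] at hle
          rcases hle with hle | hle
          · exact hle
          · exfalso
            refine h a (by simp) d (by simp) ?_
            apply ofLex.injective
            exact Prod.ext hle.1.symm (by rw [hd, ← hs]; rfl)
        intro b hb
        rcases List.mem_cons.1 hb with rfl | hb
        · exact had
        · have hle := (List.pairwise_cons.1 hL.2).1 b hb
          rw [Prod.Lex.le_iff] at hle
          rcases hle with hle | hle
          · exact had.trans hle
          · exact hle.1 ▸ had
    simp only [Multiset.mem_map, not_exists, not_and]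
    intro b hb heq
    exact absurd (hlt b (by simpa using hb)) (by rw [heq]; exact lt_irrefl _)

/-! ### The octahedral Tucker–Fan lemma -/

section Flags

variable {n : ℕ}

/-- The antipode of a set of signed coordinates. -/
def antipode (x : Finset (Fin n × Bool)) : Finset (Fin n × Bool) :=
  x.image fun p => (p.1, !p.2)

/-- Sequences of `k` signed coordinates, using each of the first `k` coordinates once. Their
initial segments form the maximal chains of nonzero sign vectors supported on the first `k`
coordinates. -/
def flags (n k : ℕ) : Finset (Fin k → Fin n × Bool) :=
  Finset.univ.filter fun w => (Function.Injective fun i => (w i).1) ∧ ∀ i, ((w i).1 : ℕ) < k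

theorem mem_flags {k : ℕ} {w : Fin k → Fin n × Bool} :
    w ∈ flags n k ↔ (Function.Injective fun i => (w i).1) ∧ ∀ i, ((w i).1 : ℕ) < k := by
  simp [flags]

/-- The set of the first signed coordinates of a sequence, up to position `i`. -/
def initialSet {k : ℕ} (w : Fin k → Fin n × Bool) (i : Fin k) : Finset (Fin n × Bool) :=
  (Finset.Iic i).image w

/-- The labels of all initial segments. -/
def flagLabels (lab : Finset (Fin n × Bool) → SignedLabel) {k : ℕ} (w : Fin k → Fin n × Bool) :
    Multiset SignedLabel :=
  (Finset.univ : Finset (Fin k)).val.map fun i => lab (initialSet w i)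

/-- The labels of all initial segments but one. -/
def facetLabels (lab : Finset (Fin n × Bool) → SignedLabel) {k : ℕ} (w : Fin k → Fin n × Bool)
    (i : Fin k) : Multiset SignedLabel :=
  ((Finset.univ : Finset (Fin k)).erase i).val.map fun i => lab (initialSet w i)

variable (lab : Finset (Fin n × Bool) → SignedLabel)

theorem sum_alternating_facetLabels {k : ℕ} (w : Fin k → Fin n × Bool) (s : Bool) :
    ∑ i, alternating s (facetLabels lab w i) =
      alternating s (flagLabels lab w) + alternating (!s) (flagLabels lab w) := by
  classical
  rw [← sum_alternating_erase, flagLabels, Multiset.map_map, Finset.sum]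
  refine congrArg _ (Multiset.map_congr rfl fun i hi => ?_)
  rw [facetLabels, Finset.erase_val, Multiset.map_erase_of_mem _ _ hi]
  rfl

theorem facetLabels_congr {k : ℕ} {w w' : Fin k → Fin n × Bool} {i : Fin k}
    (h : ∀ j, j ≠ i → initialSet w j = initialSet w' j) :
    facetLabels lab w i = facetLabels lab w' i := by
  refine Multiset.map_congr rfl fun j hj => ?_
  rw [h j (Finset.ne_of_mem_erase (Finset.mem_def.2 hj))]

theorem initialSet_comp_swap {k : ℕ} (w : Fin (k + 1) → Fin n × Bool) (i : Fin k) {j : Fin (k + 1)}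
    (hj : j ≠ i.castSucc) :
    initialSet (w ∘ Equiv.swap i.castSucc i.succ) j = initialSet w j := by
  classical
  rw [initialSet, initialSet, ← Finset.image_image]
  congr 1
  ext x
  simp only [Finset.mem_image, Finset.mem_Iic]
  have hj' : (j : ℕ) ≠ i := fun h => hj (Fin.ext h)
  have hle : i.castSucc ≤ j ↔ i.succ ≤ j := by
    simp only [Fin.le_def, Fin.val_castSucc, Fin.val_succ]
    omega
  have key : ∀ y : Fin (k + 1), Equiv.swap i.castSucc i.succ y ≤ j ↔ y ≤ j := by
    intro y
    rcases eq_or_ne y i.castSucc with rfl | h1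
    · rw [Equiv.swap_apply_left, hle]
    rcases eq_or_ne y i.succ with rfl | h2
    · rw [Equiv.swap_apply_right, hle]
    rw [Equiv.swap_apply_of_ne_of_ne h1 h2]
  constructor
  · rintro ⟨y, hy, rfl⟩
    exact (key y).2 hy
  · intro hx
    exact ⟨_, (key x).2 hx, by simp⟩

/-- The flags in the closed half space where the last coordinate is nonnegative. -/
def upperFlags (n k : ℕ) : Finset (Fin (k + 1) → Fin n × Bool) :=
  (flags n (k + 1)).filter fun w => ∀ i, ((w i).1 : ℕ) = k → (w i).2 = true

/-- Swapping entries `i` and `i + 1` changes only the omitted initial set and stays in the half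
space, so each such facet is counted twice. -/
theorem sum_alternating_facetLabels_castSucc {k : ℕ} (s : Bool) (i : Fin k) :
    ∑ w ∈ upperFlags n k, alternating s (facetLabels lab w i.castSucc) = 0 := by
  classical
  refine Finset.sum_involution (fun w _ => w ∘ Equiv.swap i.castSucc i.succ) ?_ ?_ ?_ ?_
  · intro w _
    rw [facetLabels_congr lab (w := w ∘ Equiv.swap i.castSucc i.succ) (w' := w)
      fun j hj => initialSet_comp_swap w i hj]
    exact CharTwo.add_self_eq_zero _
  · intro w hw _ heq
    have h := congrArg Prod.fst (congrFun heq i.castSucc)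
    simp only [Function.comp_apply, Equiv.swap_apply_left] at h
    have := (mem_flags.1 (Finset.mem_filter.1 hw).1).1 h
    exact absurd this.symm (Fin.castSucc_lt_succ).ne
  · intro w hw
    simp only [upperFlags, Finset.mem_filter, mem_flags] at hw ⊢
    exact ⟨⟨hw.1.1.comp (Equiv.injective _), fun j => hw.1.2 _⟩, fun j => hw.2 _⟩
  · intro w _
    ext j <;> simp

/-- Reversing the sign of the last entry. -/
def flipLast {k : ℕ} (w : Fin (k + 1) → Fin n × Bool) : Fin (k + 1) → Fin n × Bool :=
  Function.update w (Fin.last k) ((w (Fin.last k)).1, !(w (Fin.last k)).2)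

theorem flipLast_fst {k : ℕ} (w : Fin (k + 1) → Fin n × Bool) (i : Fin (k + 1)) :
    (flipLast w i).1 = (w i).1 := by
  rcases eq_or_ne i (Fin.last k) with rfl | h
  · simp [flipLast]
  · simp [flipLast, h]

/-- Facets omitting the full vector cancel under a sign change of the last entry, unless that entry
is coordinate `k`, whose sign is fixed in the half space. Those left are the flags of the equator.
-/
theorem sum_alternating_facetLabels_last {k : ℕ} (hk : k < n) (s : Bool) :
    ∑ w ∈ upperFlags n k, alternating s (facetLabels lab w (Fin.last k)) =
      ∑ w ∈ flags n k, alternating s (flagLabels lab w) := by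
  classical
  rw [← Finset.sum_filter_add_sum_filter_not (upperFlags n k)
    fun w => ((w (Fin.last k)).1 : ℕ) = k]
  have hzero : ∑ w ∈ (upperFlags n k).filter fun w => ¬((w (Fin.last k)).1 : ℕ) = k,
      alternating s (facetLabels lab w (Fin.last k)) = 0 := by
    refine Finset.sum_involution (fun w _ => flipLast w) ?_ ?_ ?_ ?_
    · intro w _
      rw [facetLabels_congr lab (w := flipLast w) (w' := w)]
      · exact CharTwo.add_self_eq_zero _
      · intro j hj
        refine Finset.image_congr fun x hx => ?_
        have hx : x ≤ j := by simpa using hx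
        exact Function.update_of_ne (hx.trans_lt (Fin.lt_last_iff_ne_last.2 hj)).ne _ _
    · intro w _ _ heq
      have h := congrArg Prod.snd (congrFun heq (Fin.last k))
      simp [flipLast] at h
    · intro w hw
      simp only [upperFlags, Finset.mem_filter, mem_flags, flipLast_fst] at hw ⊢
      refine ⟨⟨hw.1.1, fun i hi => ?_⟩, hw.2⟩
      rcases eq_or_ne i (Fin.last k) with rfl | h
      · exact absurd hi hw.2
      · rw [flipLast, Function.update_of_ne h]
        exact hw.1.2 i hi
    · intro w _
      ext j <;> rcases eq_or_ne j (Fin.last k) with rfl | h <;> simp [flipLast, *]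
  rw [hzero, add_zero]
  refine Finset.sum_nbij' (fun w => Fin.init w)
    (fun w => Fin.snoc (α := fun _ => Fin n × Bool) w (⟨k, hk⟩, true)) ?_ ?_ ?_ ?_ ?_
  · intro w hw
    simp only [upperFlags, Finset.mem_filter, mem_flags] at hw ⊢
    refine ⟨fun i j hij => ?_, fun i => ?_⟩
    · exact Fin.castSucc_injective _ (hw.1.1.1 hij)
    · have h1 := hw.1.1.2 i.castSucc
      have h2 : ((w i.castSucc).1 : ℕ) ≠ k := fun h =>
        (Fin.castSucc_lt_last i).ne (hw.1.1.1 (Fin.ext (h.trans hw.2.symm)))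
      change ((w i.castSucc).1 : ℕ) < k
      omega
  · intro w hw
    simp only [upperFlags, Finset.mem_filter, mem_flags] at hw ⊢
    have hlt : ∀ i : Fin k, (w i).1 ≠ ⟨k, hk⟩ := fun i h => (hw.2 i).ne (congrArg Fin.val h)
    refine ⟨⟨⟨fun i j => ?_, fun i => ?_⟩, fun i => ?_⟩, ?_⟩
    · induction i using Fin.lastCases with
      | last =>
        induction j using Fin.lastCases with
        | last => simp
        | cast j => simpa using fun h => absurd h.symm (hlt j)
      | cast i =>
        induction j using Fin.lastCases with
        | last => simpa using fun h => absurd h (hlt i)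
        | cast j => simpa using fun h => hw.1 h
    · induction i using Fin.lastCases with
      | last => simp
      | cast i => simpa using (hw.2 i).trans (Nat.lt_succ_self k)
    · induction i using Fin.lastCases with
      | last => simp
      | cast i => simpa using fun h => absurd h (hw.2 i).ne
    · simp
  · intro w hw
    simp only [upperFlags, Finset.mem_filter, mem_flags] at hw
    have : w (Fin.last k) = (⟨k, hk⟩, true) :=
      Prod.ext (Fin.ext hw.2) (hw.1.2 _ hw.2)
    rw [← this, Fin.snoc_init_self]
  · intro w _
    simp
  · intro w _
    congr 1
    have huniv : (Finset.univ : Finset (Fin (k + 1))).erase (Fin.last k) =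
        Finset.univ.map Fin.castSuccEmb := by
      rw [Fin.univ_castSuccEmb, Finset.erase_cons]
    rw [facetLabels, flagLabels, huniv, Finset.map_val, Multiset.map_map]
    refine Multiset.map_congr rfl fun i _ => ?_
    simp only [Function.comp_apply, initialSet]
    rw [Fin.coe_castSuccEmb, ← Fin.finsetImage_castSucc_Iic, Finset.image_image]
    rfl

/-- Reversing all signs. -/
def flipAll {k : ℕ} (w : Fin k → Fin n × Bool) : Fin k → Fin n × Bool :=
  fun i => ((w i).1, !(w i).2)

theorem initialSet_flipAll {k : ℕ} (w : Fin k → Fin n × Bool) (i : Fin k) :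
    initialSet (flipAll w) i = antipode (initialSet w i) := by
  rw [initialSet, antipode, initialSet, Finset.image_image]
  rfl

theorem injOn_initialSet {k : ℕ} {w : Fin k → Fin n × Bool} (hw : w ∈ flags n k) (i : Fin k) :
    Set.InjOn Prod.fst (initialSet w i : Set (Fin n × Bool)) := by
  intro p hp q hq hpq
  simp only [initialSet, Finset.coe_image, Set.mem_image] at hp hq
  obtain ⟨a, _, rfl⟩ := hp
  obtain ⟨b, _, rfl⟩ := hq
  rw [(mem_flags.1 hw).1 hpq]

theorem initialSet_nonempty {k : ℕ} (w : Fin k → Fin n × Bool) (i : Fin k) :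
    (initialSet w i).Nonempty :=
  ⟨w i, Finset.mem_image_of_mem _ (Finset.mem_Iic.2 le_rfl)⟩

/-- The octahedral Tucker lemma, in Ky Fan's form: an antipodal labelling of the nonzero sign
vectors, without complementary labels on comparable vectors, takes at least `n` absolute values. -/
theorem exists_flag_nodup
    (hneg : ∀ x : Finset (Fin n × Bool), x.Nonempty → Set.InjOn Prod.fst (x : Set (Fin n × Bool)) →
      lab (antipode x) = (lab x).neg)
    (hcompl : ∀ x y : Finset (Fin n × Bool), x.Nonempty →
      Set.InjOn Prod.fst (y : Set (Fin n × Bool)) → x ⊆ y → lab x ≠ (lab y).neg) :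
    ∃ w ∈ flags n n, ((flagLabels lab w).map fun a => (ofLex a).1).Nodup := by
  classical
  have hneg_neg : ∀ a : SignedLabel, a.neg.neg = a := fun a => by
    apply ofLex.injective
    simp [SignedLabel.neg]
  have hfree : ∀ k, ∀ w ∈ flags n k, ∀ a ∈ flagLabels lab w, ∀ b ∈ flagLabels lab w,
      b ≠ a.neg := by
    intro k w hw a ha b hb
    obtain ⟨i, _, rfl⟩ := Multiset.mem_map.1 ha
    obtain ⟨j, _, rfl⟩ := Multiset.mem_map.1 hb
    rcases le_total i j with hij | hij
    · intro h
      refine hcompl _ _ (initialSet_nonempty w i) (injOn_initialSet hw j)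
        (Finset.image_subset_image (Finset.Iic_subset_Iic.2 hij)) ?_
      rw [h, hneg_neg]
    · exact hcompl _ _ (initialSet_nonempty w j) (injOn_initialSet hw i)
        (Finset.image_subset_image (Finset.Iic_subset_Iic.2 hij))
  have hflip : ∀ k, ∀ w ∈ flags n k, flagLabels lab (flipAll w) =
      (flagLabels lab w).map SignedLabel.neg := by
    intro k w hw
    rw [flagLabels, flagLabels, Multiset.map_map]
    refine Multiset.map_congr rfl fun i _ => ?_
    rw [initialSet_flipAll, hneg _ (initialSet_nonempty w i) (injOn_initialSet hw i)]
    rfl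
  -- Induction on dimension: the facet sum over a hemisphere reduces to its equator, where the count
  -- is odd. By `sum_alternating_erase` it also counts the flags of the hemisphere alternating from
  -- either sign.
  have hstep : ∀ k, k ≤ n → ∑ w ∈ flags n k, alternating true (flagLabels lab w) = 1 := by
    intro k
    induction k with
    | zero =>
      intro _
      have : flags n 0 = Finset.univ := by
        refine Finset.eq_univ_of_forall fun w => mem_flags.2 ⟨fun i => i.elim0, fun i => i.elim0⟩
      rw [this, Fintype.sum_subsingleton _ (fun i => i.elim0)]
      simp [flagLabels, alternating_zero]
    | succ k ih =>
      intro hk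
      rw [← ih (by omega), ← sum_alternating_facetLabels_last lab (by omega : k < n) true]
      have hall : ∑ w ∈ upperFlags n k, ∑ i, alternating true (facetLabels lab w i) =
          ∑ w ∈ upperFlags n k, alternating true (facetLabels lab w (Fin.last k)) := by
        rw [Finset.sum_comm, Fin.sum_univ_castSucc]
        simp [sum_alternating_facetLabels_castSucc]
      rw [← hall]
      simp only [sum_alternating_facetLabels, Finset.sum_add_distrib]
      -- The antipodal map carries flags alternating from `false` in the upper hemisphere to flags
      -- alternating from `true` in the lower one.
      rw [← Finset.sum_filter_add_sum_filter_not (flags n (k + 1))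
        fun w => ∀ i, ((w i).1 : ℕ) = k → (w i).2 = true]
      refine congrArg₂ _ rfl ?_
      have hflip2 : ∀ w : Fin (k + 1) → Fin n × Bool, flipAll (flipAll w) = w := fun w => by
        ext i <;> simp [flipAll]
      have hmem : ∀ w ∈ flags n (k + 1), flipAll w ∈ flags n (k + 1) := fun w hw =>
        mem_flags.2 ⟨(mem_flags.1 hw).1, (mem_flags.1 hw).2⟩
      have hsurj : ∀ w ∈ flags n (k + 1), ∃ i, ((w i).1 : ℕ) = k := by
        intro w hw
        have hw := mem_flags.1 hw
        let f : Fin (k + 1) → Fin (k + 1) := fun i => ⟨(w i).1, hw.2 i⟩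
        have hf : Function.Injective f := fun i j hij => by
          have hval := congrArg Fin.val hij
          exact hw.1 (Fin.ext hval)
        obtain ⟨i, hi⟩ := Finite.surjective_of_injective hf (Fin.last k)
        exact ⟨i, congrArg Fin.val hi⟩
      refine Finset.sum_nbij' flipAll flipAll ?_ ?_ (fun w _ => hflip2 w) (fun w _ => hflip2 w)
        ?_
      · intro w hw
        simp only [not_forall, Finset.mem_filter] at hw
        obtain ⟨hw, i, hi, his⟩ := hw
        simp only [upperFlags, Finset.mem_filter]
        refine ⟨hmem w hw, fun j hj => ?_⟩
        have : j = i := (mem_flags.1 hw).1 (Fin.ext (hj.trans hi.symm))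
        subst this
        simpa [flipAll] using his
      · intro w hw
        simp only [upperFlags, Finset.mem_filter] at hw
        simp only [not_forall, Finset.mem_filter]
        obtain ⟨i, hi⟩ := hsurj w hw.1
        exact ⟨hmem w hw.1, i, hi, by simp [flipAll, hw.2 i hi]⟩
      · intro w hw
        have hw := (Finset.mem_filter.1 hw).1
        rw [hflip _ w hw, alternating_map_neg _ _ (hfree _ w hw), Bool.not_not]
  obtain ⟨w, hw, hne⟩ := Finset.exists_ne_zero_of_sum_ne_zero
    (by rw [hstep n le_rfl]; exact one_ne_zero)
  exact ⟨w, hw, nodup_of_alternating hne (hfree _ w hw)⟩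

end Flags

/-! ### The Lovász–Kneser theorem -/

section Kneser

variable {n : ℕ}

/-- The coordinates at which a sign vector has sign `b`. -/
def part (x : Finset (Fin n × Bool)) (b : Bool) : Finset (Fin n) :=
  Finset.univ.filter fun i => (i, b) ∈ x

theorem mem_part {x : Finset (Fin n × Bool)} {b : Bool} {i : Fin n} :
    i ∈ part x b ↔ (i, b) ∈ x := by
  simp [part]

theorem mem_antipode {x : Finset (Fin n × Bool)} {i : Fin n} {b : Bool} :
    (i, b) ∈ antipode x ↔ (i, !b) ∈ x := by
  simp only [antipode, Finset.mem_image, Prod.mk.injEq]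
  constructor
  · rintro ⟨p, hp, rfl, rfl⟩
    simpa using hp
  · intro h
    exact ⟨_, h, rfl, by simp⟩

theorem part_antipode (x : Finset (Fin n × Bool)) (b : Bool) :
    part (antipode x) b = part x (!b) := by
  ext i
  rw [mem_part, mem_part, mem_antipode]

theorem part_mono {x y : Finset (Fin n × Bool)} (h : x ⊆ y) (b : Bool) : part x b ⊆ part y b :=
  fun _ hi => mem_part.2 (h (mem_part.1 hi))

theorem disjoint_part {x : Finset (Fin n × Bool)}
    (hx : Set.InjOn Prod.fst (x : Set (Fin n × Bool))) (b : Bool) :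
    Disjoint (part x b) (part x !b) := by
  rw [Finset.disjoint_left]
  intro _ h1 h2
  have := hx (Finset.mem_coe.2 (mem_part.1 h1)) (Finset.mem_coe.2 (mem_part.1 h2)) rfl
  simp at this

theorem card_antipode (x : Finset (Fin n × Bool)) : (antipode x).card = x.card := by
  refine Finset.card_image_of_injective _ fun p q h => ?_
  simpa [Prod.ext_iff] using h

theorem card_le_card_part_add (x : Finset (Fin n × Bool)) :
    x.card ≤ (part x true).card + (part x false).card := by
  have h : x ⊆ (part x true).image (fun i => (i, true)) ∪
      (part x false).image fun i => (i, false) := by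
    rintro ⟨_, b⟩ hp
    cases b <;> simp [mem_part, hp]
  calc x.card ≤ _ := Finset.card_le_card h
    _ ≤ _ := Finset.card_union_le _ _
    _ ≤ _ := add_le_add Finset.card_image_le Finset.card_image_le

open Classical in
/-- The sign of the first nonzero coordinate. -/
noncomputable def leadingSign (x : Finset (Fin n × Bool)) : Bool :=
  decide (∃ p ∈ x, p.2 = true ∧ ∀ q ∈ x, p.1 ≤ q.1)

theorem leadingSign_eq {x : Finset (Fin n × Bool)}
    (hx : Set.InjOn Prod.fst (x : Set (Fin n × Bool))) {p : Fin n × Bool} (hp : p ∈ x)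
    (hmin : ∀ q ∈ x, p.1 ≤ q.1) : leadingSign x = p.2 := by
  rw [leadingSign, Bool.eq_iff_iff, decide_eq_true_iff]
  constructor
  · rintro ⟨q, hq, hqs, hqmin⟩
    rw [← hx hq hp (le_antisymm (hqmin p hp) (hmin q hq)), hqs]
  · intro h
    exact ⟨p, hp, h, hmin⟩

theorem injOn_antipode {x : Finset (Fin n × Bool)}
    (hx : Set.InjOn Prod.fst (x : Set (Fin n × Bool))) :
    Set.InjOn Prod.fst (antipode x : Set (Fin n × Bool)) := by
  rintro ⟨i, a⟩ hp ⟨j, b⟩ hq h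
  have h : i = j := h
  subst h
  have := hx (Finset.mem_coe.2 (mem_antipode.1 hp)) (Finset.mem_coe.2 (mem_antipode.1 hq)) rfl
  simpa using this

theorem leadingSign_antipode {x : Finset (Fin n × Bool)} (hne : x.Nonempty)
    (hx : Set.InjOn Prod.fst (x : Set (Fin n × Bool))) :
    leadingSign (antipode x) = !leadingSign x := by
  obtain ⟨p, hp, hmin⟩ := Finset.exists_min_image x Prod.fst hne
  rw [leadingSign_eq hx hp hmin,
    leadingSign_eq (injOn_antipode hx) (p := (p.1, !p.2)) (mem_antipode.2 (by simpa using hp))]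
  rintro ⟨i, b⟩ hq
  exact hmin (i, !b) (mem_antipode.1 hq)

variable (k : ℕ) (c : Finset (Fin n) → ℕ)

/-- The positive (or negative) part of a sign vector contains a `k`-set of colour `i`. -/
def HasColor (x : Finset (Fin n × Bool)) (i : ℕ) (b : Bool) : Prop :=
  ∃ S : Finset (Fin n), S.card = k ∧ S ⊆ part x b ∧ c S = i

/-- The least colour of a `k`-set contained in one of the parts of a sign vector. -/
noncomputable def leastColor (x : Finset (Fin n × Bool)) : ℕ :=
  sInf {i | ∃ b, HasColor k c x i b}

open Classical in
/-- Matoušek's labelling of the sign vectors. -/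
noncomputable def kneserLabel (x : Finset (Fin n × Bool)) : SignedLabel :=
  if x.card ≤ 2 * k - 2 then toLex (x.card - 1, leadingSign x)
  else toLex (2 * k - 2 + leastColor k c x, decide (HasColor k c x (leastColor k c x) true))

variable {k c}

theorem hasColor_antipode {x : Finset (Fin n × Bool)} {i : ℕ} {b : Bool} :
    HasColor k c (antipode x) i b ↔ HasColor k c x i !b := by
  rw [HasColor, HasColor, part_antipode]

theorem leastColor_antipode (x : Finset (Fin n × Bool)) :
    leastColor k c (antipode x) = leastColor k c x := by
  simp only [leastColor, hasColor_antipode, Bool.exists_bool, Bool.not_true, Bool.not_false, or_comm]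

theorem exists_hasColor_leastColor {x : Finset (Fin n × Bool)} (hx : ¬x.card ≤ 2 * k - 2) :
    ∃ b, HasColor k c x (leastColor k c x) b := by
  have hne : {i | ∃ b, HasColor k c x i b}.Nonempty := by
    have hcard := card_le_card_part_add x
    have : k ≤ (part x true).card ∨ k ≤ (part x false).card := by omega
    rcases this with h | h <;> obtain ⟨S, hS, hSk⟩ := Finset.exists_subset_card_eq h
    exacts [⟨c S, true, S, hSk, hS, rfl⟩, ⟨c S, false, S, hSk, hS, rfl⟩]
  exact Nat.sInf_mem hne

theorem not_hasColor_not
    (hc : ∀ S T : Finset (Fin n), S.card = k → T.card = k → Disjoint S T → c S ≠ c T)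
    {x : Finset (Fin n × Bool)} (hx : Set.InjOn Prod.fst (x : Set (Fin n × Bool))) {i : ℕ} {b : Bool}
    (h : HasColor k c x i b) : ¬HasColor k c x i !b := by
  rintro ⟨T, hT, hTx, hTi⟩
  obtain ⟨S, hS, hSx, hSi⟩ := h
  exact hc S T hS hT (Finset.disjoint_of_subset_left hSx
    (Finset.disjoint_of_subset_right hTx (disjoint_part hx b))) (hSi.trans hTi.symm)

theorem HasColor.mono {x y : Finset (Fin n × Bool)} (hxy : x ⊆ y) {i : ℕ} {b : Bool}
    (h : HasColor k c x i b) : HasColor k c y i b :=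
  let ⟨S, hS, hSx, hSi⟩ := h
  ⟨S, hS, hSx.trans (part_mono hxy b), hSi⟩

theorem exists_kneserLabel_eq
    (hc : ∀ S T : Finset (Fin n), S.card = k → T.card = k → Disjoint S T → c S ≠ c T)
    {x : Finset (Fin n × Bool)} (hx : Set.InjOn Prod.fst (x : Set (Fin n × Bool)))
    (hcard : ¬x.card ≤ 2 * k - 2) :
    ∃ b, HasColor k c x (leastColor k c x) b ∧
      kneserLabel k c x = toLex (2 * k - 2 + leastColor k c x, b) := by
  classical
  obtain ⟨b, hb⟩ := exists_hasColor_leastColor (c := c) hcard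
  refine ⟨b, hb, ?_⟩
  rw [kneserLabel, if_neg hcard]
  have := not_hasColor_not hc hx hb
  cases b
  · simp only [Bool.not_false] at this
    simp [this]
  · simp [hb]

/-- The Lovász–Kneser theorem: a colouring of the `k`-subsets of an `n`-set for which disjoint
subsets get different colours uses at least `n - 2k + 2` colours. -/
theorem le_of_kneser_coloring {C : ℕ} (hC : ∀ S : Finset (Fin n), S.card = k → c S < C)
    (hc : ∀ S T : Finset (Fin n), S.card = k → T.card = k → Disjoint S T → c S ≠ c T) :
    n ≤ 2 * k - 2 + C := by
  classical
  -- Complementary labels on `x ⊆ y` would have equal numbers. For small vectors this forces `x =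
  -- y`, with two leading signs; for large ones, both parts of `y` would contain a `k`-set of the
  -- same colour. Small and large vectors have disjoint ranges of numbers.
  obtain ⟨w, hw, hnodup⟩ := exists_flag_nodup (kneserLabel k c) (n := n) (by
    intro x hne hx
    by_cases hcard : x.card ≤ 2 * k - 2
    · rw [kneserLabel, kneserLabel, card_antipode, if_pos hcard, if_pos hcard,
        leadingSign_antipode hne hx]
      rfl
    · obtain ⟨b, hb, hlab⟩ := exists_kneserLabel_eq hc hx hcard
      obtain ⟨b', hb', hlab'⟩ := exists_kneserLabel_eq hc (injOn_antipode hx)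
        (by rwa [card_antipode])
      rw [leastColor_antipode] at hb' hlab'
      rw [hasColor_antipode] at hb'
      have hbb : b' = !b := by
        by_contra hne
        have : (!b') = !b := by simpa using hne
        exact not_hasColor_not hc hx hb (this ▸ hb')
      rw [hlab, hlab', hbb]
      rfl) (by
    intro x y hne hy hxy heq
    have hx : Set.InjOn Prod.fst (x : Set (Fin n × Bool)) := hy.mono (by exact_mod_cast hxy)
    have hpos := hne.card_pos
    have hle := Finset.card_le_card hxy
    by_cases hcx : x.card ≤ 2 * k - 2 <;> by_cases hcy : y.card ≤ 2 * k - 2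
    · rw [kneserLabel, kneserLabel, if_pos hcx, if_pos hcy] at heq
      have h1 : x.card - 1 = y.card - 1 := congrArg (fun a => (ofLex a).1) heq
      have h2 : leadingSign x = !leadingSign y := congrArg (fun a => (ofLex a).2) heq
      rw [Finset.eq_of_subset_of_card_le hxy (by omega)] at h2
      simp at h2
    · obtain ⟨b, _, hlab⟩ := exists_kneserLabel_eq hc hy hcy
      rw [kneserLabel, if_pos hcx, hlab] at heq
      have h1 : x.card - 1 = 2 * k - 2 + leastColor k c y := congrArg (fun a => (ofLex a).1) heq
      omega
    · omega
    · obtain ⟨a, ha, hlabx⟩ := exists_kneserLabel_eq hc hx hcx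
      obtain ⟨b, hb, hlaby⟩ := exists_kneserLabel_eq hc hy hcy
      rw [hlabx, hlaby] at heq
      have h1 : 2 * k - 2 + leastColor k c x = 2 * k - 2 + leastColor k c y :=
        congrArg (fun a => (ofLex a).1) heq
      have h2 : a = !b := congrArg (fun a => (ofLex a).2) heq
      rw [Nat.add_left_cancel h1, h2] at ha
      exact not_hasColor_not hc hy hb (ha.mono hxy))
  -- The `n` distinct numbers on the flag all lie below `2k - 2 + C`: small vectors use those below
  -- `2k - 2`, large ones a shifted colour.
  have hsub : ((flagLabels (kneserLabel k c) w).map fun a => (ofLex a).1).toFinset ⊆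
      Finset.range (2 * k - 2 + C) := by
    intro i hi
    simp only [flagLabels, Multiset.map_map, Multiset.mem_toFinset, Multiset.mem_map,
      Function.comp_apply] at hi
    obtain ⟨j, _, rfl⟩ := hi
    rw [Finset.mem_range]
    have hpos := (initialSet_nonempty w j).card_pos
    by_cases hcard : (initialSet w j).card ≤ 2 * k - 2
    · rw [kneserLabel, if_pos hcard, ofLex_toLex]
      dsimp only
      omega
    · obtain ⟨b, ⟨S, hS, _, hSi⟩, hlab⟩ := exists_kneserLabel_eq hc (injOn_initialSet hw j) hcard
      have := hC S hS
      rw [hlab, ofLex_toLex]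
      dsimp only
      omega
  have hcard := Finset.card_le_card hsub
  rw [Multiset.toFinset_card_of_nodup hnodup, Finset.card_range] at hcard
  simpa [flagLabels] using hcard

end Kneser

/-! ### Matchings as sets of disjoint edges -/

section Matchings

variable {V : Type*} {G : SimpleGraph V}

theorem eq_of_mem_edgeSet {M : G.Subgraph} (hM : M.IsMatching) {e f : Sym2 V} (he : e ∈ M.edgeSet)
    (hf : f ∈ M.edgeSet) {v : V} (hve : v ∈ e) (hvf : v ∈ f) : e = f := by
  obtain ⟨x, rfl⟩ := Sym2.mem_iff_exists.1 hve
  obtain ⟨y, rfl⟩ := Sym2.mem_iff_exists.1 hvf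
  rw [SimpleGraph.Subgraph.mem_edgeSet] at he hf
  rw [hM.eq_of_adj_left he hf]

/-- The number of edges of a matching touching a vertex set `C` is at most the size of `C`. -/
theorem encard_le_card_of_cover {M : G.Subgraph} (hM : M.IsMatching) {S : Set (Sym2 V)}
    (hS : S ⊆ M.edgeSet) (C : Finset V) (hC : ∀ e ∈ S, ∃ v ∈ C, v ∈ e) : S.encard ≤ C.card := by
  rcases S.eq_empty_or_nonempty with rfl | ⟨e₀, he₀⟩
  · simp
  obtain ⟨v₀, -⟩ := hC e₀ he₀
  have : Nonempty V := ⟨v₀⟩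
  choose! f hfC hfe using hC
  rw [← Set.encard_coe_eq_coe_finsetCard]
  refine Set.encard_le_encard_of_injOn (f := f) (fun e he => hfC e he) fun e he e' he' h => ?_
  exact eq_of_mem_edgeSet hM (hS he) (hS he') (hfe e he) (h ▸ hfe e' he')

/-- A set of pairwise vertex-disjoint edges is the edge set of a matching. -/
theorem exists_isMatching_edgeSet_eq {F : Set (Sym2 V)} (hF : F ⊆ G.edgeSet)
    (hdisj : ∀ e ∈ F, ∀ f ∈ F, ∀ v, v ∈ e → v ∈ f → e = f) :
    ∃ M : G.Subgraph, M.IsMatching ∧ M.edgeSet = F := by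
  refine ⟨{ verts := {v | ∃ w, s(v, w) ∈ F}
            Adj := fun v w => s(v, w) ∈ F
            adj_sub := fun h => hF h
            edge_vert := fun h => ⟨_, h⟩
            symm := ⟨fun v w h => by rwa [Sym2.eq_swap]⟩ }, ?_, ?_⟩
  · rintro v ⟨w, hw⟩
    refine ⟨w, hw, fun y hy => ?_⟩
    exact Sym2.congr_right.1 (hdisj _ hy _ hw v (Sym2.mem_mk_left _ _) (Sym2.mem_mk_left _ _))
  · ext e
    induction e using Sym2.ind with
    | _ v w => rfl

end Matchings

/-! ### The spider and its matchings -/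

/-- The vertices of a spider with `n` legs of length two, to whose centre `s` stars are attached. -/
inductive SpiderVertex (n s : ℕ) : Type
  | center : SpiderVertex n s
  | mid (i : Fin n) : SpiderVertex n s
  | outer (i : Fin n) : SpiderVertex n s
  | hub (j : Fin s) : SpiderVertex n s
  | leaf (j : Fin s) (A : Finset (Fin n)) : SpiderVertex n s

namespace SpiderVertex

variable {n s : ℕ}

instance : Finite (SpiderVertex n s) := by
  refine Finite.of_surjective (α := Unit ⊕ Fin n ⊕ Fin n ⊕ Fin s ⊕ Fin s × Finset (Fin n))
    (fun x => match x with
      | .inl _ => center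
      | .inr (.inl i) => mid i
      | .inr (.inr (.inl i)) => outer i
      | .inr (.inr (.inr (.inl j))) => hub j
      | .inr (.inr (.inr (.inr (j, A)))) => leaf j A) ?_
  rintro (_ | i | i | j | ⟨j, A⟩)
  exacts [⟨.inl (), rfl⟩, ⟨.inr (.inl i), rfl⟩, ⟨.inr (.inr (.inl i)), rfl⟩,
    ⟨.inr (.inr (.inr (.inl j))), rfl⟩, ⟨.inr (.inr (.inr (.inr (j, A)))), rfl⟩]

/-- The neighbour of a vertex on the path to the centre. -/
def parent : SpiderVertex n s → SpiderVertex n s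
  | center => center
  | mid _ => center
  | outer i => mid i
  | hub _ => center
  | leaf j _ => hub j

/-- The edge from a vertex towards the centre. -/
def upEdge (v : SpiderVertex n s) : Sym2 (SpiderVertex n s) := s(v, v.parent)

/-- The centre is its own parent, so its `upEdge` is a loop and needs no exception. -/
theorem upEdge_injective : Function.Injective (upEdge : SpiderVertex n s → _) := by
  rintro (_ | i | i | j | ⟨j, A⟩) (_ | i' | i' | j' | ⟨j', A'⟩) h <;>
    simp_all [upEdge, parent]

end SpiderVertex

open SpiderVertex

variable {n s k : ℕ}

/-- The tree in which every vertex is joined to its parent. -/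
def spider (n s : ℕ) : SimpleGraph (SpiderVertex n s) :=
  SimpleGraph.fromRel fun v w => v.parent = w

theorem upEdge_mem_edgeSet {v : SpiderVertex n s} (hv : v ≠ center) :
    v.upEdge ∈ (spider n s).edgeSet := by
  rw [upEdge, SimpleGraph.mem_edgeSet, spider, SimpleGraph.fromRel_adj]
  refine ⟨?_, Or.inl rfl⟩
  cases v <;> simp_all [parent]

theorem exists_eq_upEdge {e : Sym2 (SpiderVertex n s)} (he : e ∈ (spider n s).edgeSet) :
    ∃ v, v ≠ center ∧ e = v.upEdge := by
  induction e using Sym2.ind with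
  | _ v w =>
    rw [SimpleGraph.mem_edgeSet, spider, SimpleGraph.fromRel_adj] at he
    obtain ⟨hne, rfl | rfl⟩ := he
    · exact ⟨v, fun h => hne (by rw [h]; rfl), rfl⟩
    · exact ⟨w, fun h => hne (by rw [h]; rfl), Sym2.eq_swap⟩

theorem spider_adj_parent {v : SpiderVertex n s} (hv : v ≠ center) :
    (spider n s).Adj v v.parent :=
  upEdge_mem_edgeSet hv

theorem spider_connected : (spider n s).Connected := by
  have hreach : ∀ v : SpiderVertex n s, (spider n s).Reachable v center := by
    intro v
    rcases v with _ | i | i | j | ⟨j, A⟩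
    · exact SimpleGraph.Reachable.refl _
    · exact (spider_adj_parent (v := mid i) (by simp)).reachable
    · exact (spider_adj_parent (v := outer i) (by simp)).reachable.trans
        (spider_adj_parent (v := mid i) (by simp)).reachable
    · exact (spider_adj_parent (v := hub j) (by simp)).reachable
    · exact (spider_adj_parent (v := leaf j A) (by simp)).reachable.trans
        (spider_adj_parent (v := hub j) (by simp)).reachable
  have : Nonempty (SpiderVertex n s) := ⟨center⟩
  exact ⟨fun v w => (hreach v).trans (hreach w).symm⟩

theorem spider_isBipartite : (spider n s).IsBipartite := by
  let f : SpiderVertex n s → Bool := fun v => match v with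
    | center => true
    | mid _ => false
    | outer _ => true
    | hub _ => false
    | leaf _ _ => true
  have hf : ∀ v : SpiderVertex n s, v ≠ v.parent → f v ≠ f v.parent := by
    rintro (_ | i | i | j | ⟨j, A⟩) h <;> simp_all [parent, f]
  have hcol : ∀ {v w}, (spider n s).Adj v w → f v ≠ f w := by
    intro v w h
    rw [spider, SimpleGraph.fromRel_adj] at h
    obtain ⟨hne, rfl | rfl⟩ := h
    · exact hf v hne
    · exact (hf w hne.symm).symm
  simpa using (SimpleGraph.Coloring.mk f hcol).colorable

/-- The lower ends of the edges of a matching: legs `A` use their outer edge, legs `B` their inner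
edge, and the `j`-th star the leaf `t j`. -/
def lowerEnds (A B : Set (Fin n)) (t : Fin s → Finset (Fin n)) : Set (SpiderVertex n s) :=
  outer '' A ∪ mid '' B ∪ Set.range fun j => leaf j (t j)

theorem encard_lowerEnds (A B : Set (Fin n)) (t : Fin s → Finset (Fin n)) :
    (lowerEnds A B t).encard = A.encard + B.encard + s := by
  rw [lowerEnds, Set.encard_union_eq, Set.encard_union_eq, ← Set.image_univ,
    Function.Injective.encard_image, Function.Injective.encard_image,
    Function.Injective.encard_image, Set.encard_univ]
  · simp
  · intro i j h
    simpa using (SpiderVertex.leaf.inj h).1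
  · intro i j h
    simpa using h
  · intro i j h
    simpa using h
  · rw [Set.disjoint_left]
    rintro _ ⟨i, _, rfl⟩ ⟨j, _, h⟩
    cases h
  · rw [Set.disjoint_left]
    rintro _ (⟨i, _, rfl⟩ | ⟨i, _, rfl⟩) ⟨j, h⟩ <;> cases h

theorem ne_center_of_mem_lowerEnds {A B : Set (Fin n)} {t : Fin s → Finset (Fin n)}
    {v : SpiderVertex n s} (hv : v ∈ lowerEnds A B t) : v ≠ center := by
  rcases hv with (⟨i, _, rfl⟩ | ⟨i, _, rfl⟩) | ⟨j, rfl⟩ <;> simp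

/-- Inner edges share the centre, so `B` has at most one element; the two edges of a leg share its
middle vertex, so `A` and `B` are disjoint. -/
theorem exists_isMatching_of_lowerEnds {H : SimpleGraph (SpiderVertex n s)} {A B : Set (Fin n)}
    (hAB : Disjoint A B) (hB : B.Subsingleton) (t : Fin s → Finset (Fin n))
    (hH : upEdge '' lowerEnds A B t ⊆ H.edgeSet) :
    ∃ M : H.Subgraph, M.IsMatching ∧ M.edgeSet = upEdge '' lowerEnds A B t := by
  refine exists_isMatching_edgeSet_eq hH ?_
  rw [Set.disjoint_left] at hAB
  rintro _ ⟨v, hv, rfl⟩ _ ⟨w, hw, rfl⟩ x hxv hxw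
  congr 1
  rcases hv with (⟨i, hi, rfl⟩ | ⟨i, hi, rfl⟩) | ⟨j, rfl⟩ <;>
  rcases hw with (⟨i', hi', rfl⟩ | ⟨i', hi', rfl⟩) | ⟨j', rfl⟩ <;>
  simp only [upEdge, parent, Sym2.mem_iff] at hxv hxw <;>
  rcases hxv with rfl | rfl <;> simp_all
  all_goals exact hB hi hi'

/-- The centre of the spider and the centres of the stars. -/
def centers (n s : ℕ) : Finset (SpiderVertex n s) :=
  Finset.cons center (Finset.univ.map ⟨hub, fun _ _ h => by simpa using h⟩) (by simp)

theorem card_centers : (centers n s).card = s + 1 := by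
  simp [centers]

theorem exists_mem_centers {v : SpiderVertex n s} (hv : ∀ i, v ≠ outer i) :
    ∃ x ∈ centers n s, x ∈ v.upEdge := by
  rcases v with _ | i | i | j | ⟨j, A⟩
  · exact ⟨center, by simp [centers], by simp [upEdge]⟩
  · exact ⟨center, by simp [centers], by simp [upEdge, parent]⟩
  · exact absurd rfl (hv i)
  · exact ⟨center, by simp [centers], by simp [upEdge, parent]⟩
  · exact ⟨hub j, by simpa [centers] using ⟨j, rfl⟩, by simp [upEdge, parent]⟩

open Classical in
/-- The legs whose outer edge lies in a given subgraph. -/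
noncomputable def outerLegs {H : SimpleGraph (SpiderVertex n s)} (M : H.Subgraph) :
    Finset (Fin n) :=
  Finset.univ.filter fun i => (outer i).upEdge ∈ M.edgeSet

theorem mem_outerLegs {H : SimpleGraph (SpiderVertex n s)} {M : H.Subgraph} {i : Fin n} :
    i ∈ outerLegs M ↔ (outer i).upEdge ∈ M.edgeSet := by
  simp [outerLegs]

/-- The `s + 1` centres cover all edges that are not outer, and a matching has at most one edge at
each of them. -/
theorem encard_le_card_outerLegs {H : SimpleGraph (SpiderVertex n s)} (hH : H ≤ spider n s)
    {M : H.Subgraph} (hM : M.IsMatching) : M.edgeSet.encard ≤ (outerLegs M).card + (s + 1) := by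
  classical
  let T : Set (Sym2 (SpiderVertex n s)) := (fun i => (outer i).upEdge) '' (outerLegs M : Set (Fin n))
  have hrest : (M.edgeSet \ T).encard ≤ (centers n s).card := by
    refine encard_le_card_of_cover hM Set.sdiff_subset _ ?_
    rintro e ⟨he, heT⟩
    obtain ⟨v, -, rfl⟩ := exists_eq_upEdge (SimpleGraph.edgeSet_mono hH (M.edgeSet_subset he))
    refine exists_mem_centers fun i hi => heT ⟨i, ?_, by rw [hi]⟩
    exact mem_outerLegs.2 (hi ▸ he)
  calc M.edgeSet.encard ≤ (T ∪ M.edgeSet \ T).encard :=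
        Set.encard_le_encard (by rw [Set.union_sdiff_self]; exact Set.subset_union_right)
    _ ≤ T.encard + (M.edgeSet \ T).encard := Set.encard_union_le _ _
    _ ≤ (outerLegs M).card + (s + 1) := by
        refine add_le_add ((Set.encard_image_le _ _).trans ?_) (hrest.trans ?_)
        · rw [Set.encard_coe_eq_coe_finsetCard]
        · rw [card_centers]
          norm_cast

/-- Every matching with `s + k + 1` edges of the spider uses at least `k` outer edges. -/
theorem le_card_outerLegs (M : RMatching (spider n s) (s + k + 1)) :
    k ≤ (outerLegs M.1).card := by
  have h := encard_le_card_outerLegs le_rfl M.2.1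
  rw [M.2.2] at h
  have h : s + k + 1 ≤ (outerLegs M.1).card + (s + 1) := by exact_mod_cast h
  omega

/-! ### The chromatic number -/

theorem matchingKneserGraph_spider_colorable {c : ℕ} (hc : 1 ≤ c) (hk : 1 ≤ k) (hn : n + 2 = c + 2 * k) :
    (matchingKneserGraph (spider n s) (s + k + 1)).Colorable c := by
  classical
  -- The colour is the index of an outer leg among the first `c - 1`, if there is one. In the last
  -- class all outer legs lie among the remaining `n - (c - 1) = 2k - 1`, too few for two disjoint
  -- `k`-sets.
  let f : RMatching (spider n s) (s + k + 1) → ℕ := fun M =>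
    if h : ∃ i ∈ outerLegs M.1, (i : ℕ) < c - 1 then h.choose else c - 1
  have hfc : ∀ M, f M < c := by
    intro M
    simp only [f]
    split_ifs with h
    · have := h.choose_spec.2
      omega
    · omega
  have hf1 : ∀ M, f M < c - 1 → ∃ i ∈ outerLegs M.1, (i : ℕ) = f M := by
    intro M hM
    simp only [f] at hM ⊢
    split_ifs at hM ⊢ with h
    · exact ⟨_, h.choose_spec.1, rfl⟩
    · omega
  have hf2 : ∀ M, f M = c - 1 → ∀ i ∈ outerLegs M.1, c - 1 ≤ (i : ℕ) := by
    intro M hM i hi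
    by_contra hlt
    have h : ∃ i ∈ outerLegs M.1, (i : ℕ) < c - 1 := ⟨i, hi, by omega⟩
    have hM' : f M = (h.choose : ℕ) := by
      simp only [f]
      rw [dif_pos h]
    have := h.choose_spec.2
    omega
  have hdisj : ∀ {M N}, (matchingKneserGraph (spider n s) (s + k + 1)).Adj M N →
      Disjoint (outerLegs M.1) (outerLegs N.1) := by
    intro M N h
    rw [Finset.disjoint_left]
    intro i hi hi'
    exact Set.disjoint_left.1 h.2 (mem_outerLegs.1 hi) (mem_outerLegs.1 hi')
  refine ⟨SimpleGraph.Coloring.mk (fun M => (⟨f M, hfc M⟩ : Fin c)) fun {M N} h heq => ?_⟩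
  have heq : f M = f N := congrArg Fin.val heq
  by_cases hM : f M < c - 1
  · obtain ⟨i, hi, hif⟩ := hf1 M hM
    obtain ⟨j, hj, hjf⟩ := hf1 N (by omega)
    have : i = j := Fin.ext (by omega)
    subst this
    exact Finset.disjoint_left.1 (hdisj h) hi hj
  · have hMc : f M = c - 1 := by have := hfc M; omega
    have hsub : outerLegs M.1 ∪ outerLegs N.1 ⊆
        Finset.univ.filter fun i : Fin n => ¬(i : ℕ) < c - 1 := by
      intro i hi
      rw [Finset.mem_filter]
      refine ⟨Finset.mem_univ _, ?_⟩
      rcases Finset.mem_union.1 hi with hi | hi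
      · have := hf2 M hMc i hi
        omega
      · have := hf2 N (by omega) i hi
        omega
    have hcard := Finset.card_le_card hsub
    rw [Finset.card_union_of_disjoint (hdisj h)] at hcard
    have h1 := le_card_outerLegs M
    have h2 := le_card_outerLegs N
    have h3 := Finset.card_filter_add_card_filter_not (s := (Finset.univ : Finset (Fin n)))
      (fun i : Fin n => (i : ℕ) < c - 1)
    rw [Fin.card_filter_val_lt, Finset.card_univ, Fintype.card_fin] at h3
    omega

/-- A choice of an element outside each nonempty proper subset of `Fin n`, with different choices
for disjoint subsets. -/
theorem exists_outside_choice (n : ℕ) : ∃ b : Finset (Fin n) → Set (Fin n),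
    (∀ S, (b S).Subsingleton) ∧ (∀ S : Finset (Fin n), Disjoint (S : Set (Fin n)) (b S)) ∧
    (∀ S, S.Nonempty → S ≠ Finset.univ → (b S).Nonempty) ∧
    ∀ S T, Disjoint S T → Disjoint (b S) (b T) := by
  classical
  rcases n.eq_zero_or_pos with rfl | hn
  · refine ⟨fun _ => ∅, by simp, by simp, ?_, by simp⟩
    rintro S ⟨i, _⟩
    exact i.elim0
  have : NeZero n := ⟨hn.ne'⟩
  -- A nonempty proper subset of a cycle is not closed under successor. The choice is `a + 1` for
  -- some `a ∈ S`, and disjoint sets have different `a`.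
  have hex : ∀ S : Finset (Fin n), S.Nonempty → S ≠ Finset.univ → ∃ a ∈ S, a + 1 ∉ S := by
    rintro S ⟨a, ha⟩ hS
    by_contra! hcl
    refine hS (Finset.eq_univ_of_forall fun b => ?_)
    have hj : ∀ j : ℕ, a + (Fin.ofNat n j) ∈ S := by
      intro j
      induction j with
      | zero => simpa using ha
      | succ j ih =>
        have := hcl _ ih
        rw [add_assoc] at this
        convert this using 2
        apply Fin.ext
        simp [Fin.val_add]
    have := hj (b - a).val
    simpa using this
  let b : Finset (Fin n) → Set (Fin n) := fun S =>
    if h : S.Nonempty ∧ S ≠ Finset.univ then {(hex S h.1 h.2).choose + 1} else ∅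
  have hb : ∀ S, ∀ x ∈ b S, x ∉ S ∧ ∃ a ∈ S, x = a + 1 := by
    intro S x hx
    simp only [b] at hx
    split_ifs at hx with h
    · rw [Set.mem_singleton_iff] at hx
      subst hx
      exact ⟨(hex S h.1 h.2).choose_spec.2, _, (hex S h.1 h.2).choose_spec.1, rfl⟩
    · exact hx.elim
  refine ⟨b, fun S => ?_, fun S => ?_, fun S h1 h2 => ?_, fun S T h => ?_⟩
  · simp only [b]
    split_ifs
    · exact Set.subsingleton_singleton
    · exact Set.subsingleton_empty
  · rw [Set.disjoint_right]
    intro x hx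
    simpa using (hb S x hx).1
  · simp only [b]
    rw [dif_pos ⟨h1, h2⟩]
    exact Set.singleton_nonempty _
  · rw [Set.disjoint_left]
    intro x hx hx'
    obtain ⟨-, a, ha, rfl⟩ := hb S x hx
    obtain ⟨-, a', ha', h'⟩ := hb T _ hx'
    rw [add_right_cancel h'] at ha
    exact Finset.disjoint_left.1 h ha ha'

/-- Each `k`-set `S` gives the matching with outer edges on `S`, the inner edge of the leg in `b S`,
and the leaf indexed by `S` in every star. Having one leaf per subset keeps these matchings disjoint
in the stars. -/
theorem le_of_matchingKneserGraph_spider_colorable {c : ℕ} (hk : 1 ≤ k) (hkn : k < n)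
    (hcol : (matchingKneserGraph (spider n s) (s + k + 1)).Colorable c) :
    n ≤ 2 * k - 2 + c := by
  classical
  obtain ⟨C⟩ := hcol
  obtain ⟨b, hb1, hb2, hb3, hb4⟩ := exists_outside_choice n
  have hM : ∀ S : Finset (Fin n), S.card = k → ∃ M : RMatching (spider n s) (s + k + 1),
      M.1.edgeSet = upEdge '' lowerEnds (S : Set (Fin n)) (b S) fun _ => S := by
    intro S hS
    obtain ⟨M, hM, hMe⟩ := exists_isMatching_of_lowerEnds (H := spider n s) (hb2 S) (hb1 S)
      (fun _ => S) (by
        rintro _ ⟨v, hv, rfl⟩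
        exact upEdge_mem_edgeSet (ne_center_of_mem_lowerEnds hv))
    refine ⟨⟨M, hM, ?_⟩, hMe⟩
    obtain ⟨x, hx⟩ := hb3 S (Finset.card_pos.1 (by omega)) (fun h => by
      rw [h, Finset.card_univ, Fintype.card_fin] at hS
      omega)
    rw [hMe, upEdge_injective.encard_image, encard_lowerEnds, Set.encard_coe_eq_coe_finsetCard, hS,
      (hb1 S).eq_singleton_of_mem hx, Set.encard_singleton]
    push_cast
    ring
  choose M hM using hM
  have hlt : ∀ S : Finset (Fin n), ∀ hS : S.card = k,
      (if h : S.card = k then (C (M S h) : ℕ) else 0) = C (M S hS) := fun S hS => dif_pos hS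
  refine le_of_kneser_coloring (k := k)
    (c := fun S => if h : S.card = k then (C (M S h) : ℕ) else 0) (fun S hS => ?_)
    fun S T hS hT hST => ?_
  · rw [hlt S hS]
    exact (C _).isLt
  · rw [hlt S hS, hlt T hT]
    intro heq
    have hne : S ≠ T := by
      rintro rfl
      rw [disjoint_self] at hST
      rw [hST] at hS
      simp at hS
      omega
    have hdisj : Disjoint (M S hS).1.edgeSet (M T hT).1.edgeSet := by
      rw [hM, hM, Set.disjoint_image_iff upEdge_injective, Set.disjoint_left]
      rintro _ ((⟨i, hi, rfl⟩ | ⟨i, hi, rfl⟩) | ⟨j, rfl⟩) ((⟨i', hi', h⟩ | ⟨i', hi', h⟩) | ⟨j', h⟩)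
      all_goals cases h
      · exact Finset.disjoint_left.1 hST hi hi'
      · exact Set.disjoint_left.1 (hb4 S T hST) hi hi'
      · exact hne rfl
    refine C.valid (v := M S hS) (w := M T hT) ⟨fun h => ?_, hdisj⟩ (Fin.ext heq)
    rw [h, disjoint_self] at hdisj
    have h0 := (M T hT).2.2
    simp only [hdisj, Set.bot_eq_empty, Set.encard_empty] at h0
    have h0 : 0 = s + k + 1 := by exact_mod_cast h0
    omega

/-! ### The generalized Turán number -/

/-- A subgraph of the spider missing few edges contains a large matching. -/
theorem exists_rMatching_of_ncard_diff {H : SimpleGraph (SpiderVertex n s)} (hkn : k < n)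
    (hR : ((spider n s).edgeSet \ H.edgeSet).ncard ≤ n - k) :
    Nonempty (RMatching H (s + k + 1)) := by
  classical
  set R := (spider n s).edgeSet \ H.edgeSet with hRdef
  have hmem : ∀ {v : SpiderVertex n s}, v ≠ center → (v.upEdge ∈ H.edgeSet ∨ v.upEdge ∈ R) := by
    intro v hv
    by_cases h : v.upEdge ∈ H.edgeSet
    · exact Or.inl h
    · exact Or.inr ⟨upEdge_mem_edgeSet hv, h⟩
  have hRfin : R.Finite := Set.toFinite _
  -- A star has `2 ^ n > n - k` leaf edges, so one survives.
  have hleaf : ∀ j : Fin s, ∃ X, (leaf j X : SpiderVertex n s).upEdge ∈ H.edgeSet := by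
    intro j
    by_contra! hno
    have hsub : (fun X => (leaf j X : SpiderVertex n s).upEdge) '' Set.univ ⊆ R := by
      rintro _ ⟨X, -, rfl⟩
      exact (hmem (by simp)).resolve_left (hno X)
    have hle := Set.ncard_le_ncard hsub hRfin
    rw [Set.ncard_image_of_injective, Set.ncard_univ, Nat.card_eq_fintype_card,
      Fintype.card_finset, Fintype.card_fin] at hle
    · have := n.lt_two_pow_self
      omega
    · intro X Y h
      exact (SpiderVertex.leaf.inj (upEdge_injective h)).2
  choose t ht using hleaf
  let A : Finset (Fin n) := Finset.univ.filter fun i => (outer i).upEdge ∈ H.edgeSet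
  have hA : ∀ {i}, i ∈ A ↔ (outer i : SpiderVertex n s).upEdge ∈ H.edgeSet := by simp [A]
  have hAR : (fun i => (outer i : SpiderVertex n s).upEdge) '' ((Aᶜ : Finset (Fin n)) : Set (Fin n))
      ⊆ R := by
    rintro _ ⟨i, hi, rfl⟩
    exact (hmem (by simp)).resolve_left fun h => by simp [hA.2 h] at hi
  have hinj : Function.Injective fun i => (outer i : SpiderVertex n s).upEdge := fun i j h =>
    SpiderVertex.outer.inj (upEdge_injective h)
  have hAc : ((fun i => (outer i : SpiderVertex n s).upEdge) ''
      ((Aᶜ : Finset (Fin n)) : Set (Fin n))).ncard = n - A.card := by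
    rw [Set.ncard_image_of_injective _ hinj, Set.ncard_coe_finset, Finset.card_compl,
      Fintype.card_fin]
  have hle := Set.ncard_le_ncard hAR hRfin
  rw [hAc] at hle
  have hAn : A.card ≤ n := by simpa using A.card_le_univ
  -- At least `k` outer edges survive. If exactly `k` do, all `n - k` missing edges are outer, so
  -- every inner edge survives, and one on a leg outside `A` completes the matching.
  have key : ∃ A' B : Set (Fin n), A' ⊆ A ∧ Disjoint A' B ∧ B.Subsingleton ∧
      (∀ i ∈ B, (mid i : SpiderVertex n s).upEdge ∈ H.edgeSet) ∧
      A'.encard + B.encard = (k + 1 : ℕ) := by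
    by_cases hAk : k + 1 ≤ A.card
    · obtain ⟨A', hA', hcard⟩ := Finset.exists_subset_card_eq hAk
      exact ⟨A', ∅, by exact_mod_cast hA', by simp, by simp, by simp, by simp [hcard]⟩
    · have hAk : A.card = k := by omega
      obtain ⟨i, hi⟩ : ∃ i, i ∉ A := by
        by_contra! hall
        rw [Finset.eq_univ_of_forall hall, Finset.card_univ, Fintype.card_fin] at hAk
        omega
      refine ⟨A, {i}, subset_rfl, by simpa using hi, by simp, ?_, by simp [hAk]⟩
      rintro j -
      refine (hmem (by simp)).resolve_right fun hj => ?_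
      rw [← Set.eq_of_subset_of_ncard_le hAR (by omega) hRfin] at hj
      obtain ⟨i', -, h⟩ := hj
      cases upEdge_injective h
  obtain ⟨A', B, hA', hAB, hB, hBH, hcard⟩ := key
  obtain ⟨M, hM, hMe⟩ := exists_isMatching_of_lowerEnds (H := H) hAB hB t (by
    rintro _ ⟨_, (⟨i, hi, rfl⟩ | ⟨i, hi, rfl⟩) | ⟨j, rfl⟩, rfl⟩
    exacts [hA.1 (hA' hi), hBH i hi, ht j])
  refine ⟨⟨M, hM, ?_⟩⟩
  rw [hMe, upEdge_injective.encard_image, encard_lowerEnds, hcard]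
  push_cast
  ring

/-- Deleting `n - k + 1` outer edges leaves only `k - 1`, too few for a matching of this size;
`exists_rMatching_of_ncard_diff` shows that fewer deletions do not suffice. -/
theorem ncard_sub_exMatching_spider (hk : 1 ≤ k) (hkn : k < n) :
    ((spider n s).edgeSet.ncard : ℤ) - (exMatching (spider n s) (s + k + 1) : ℤ) =
      (n : ℤ) - k + 1 := by
  classical
  obtain ⟨D, -, hD⟩ := Finset.exists_subset_card_eq
    (s := (Finset.univ : Finset (Fin n))) (n := n - k + 1) (by simp; omega)
  let R : Set (Sym2 (SpiderVertex n s)) := (fun i => (outer i).upEdge) '' (D : Set (Fin n))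
  have hRsub : R ⊆ (spider n s).edgeSet := by
    rintro _ ⟨i, -, rfl⟩
    exact upEdge_mem_edgeSet (by simp)
  have hRcard : R.ncard = n - k + 1 := by
    rw [Set.ncard_image_of_injective _ fun i j h => SpiderVertex.outer.inj (upEdge_injective h),
      Set.ncard_coe_finset, hD]
  -- Makes the truncated subtraction in `hex` exact.
  have hRle := Set.ncard_le_ncard hRsub (Set.toFinite _)
  have hex : exMatching (spider n s) (s + k + 1) = (spider n s).edgeSet.ncard - (n - k + 1) := by
    refine IsGreatest.csSup_eq ⟨⟨(spider n s).deleteEdges R, SimpleGraph.deleteEdges_le _, ?_, ?_⟩, ?_⟩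
    · refine ⟨fun M => ?_⟩
      have h := encard_le_card_outerLegs (SimpleGraph.deleteEdges_le _) M.2.1
      rw [M.2.2] at h
      have h : s + k + 1 ≤ (outerLegs M.1).card + (s + 1) := by exact_mod_cast h
      have hsub : outerLegs M.1 ⊆ Dᶜ := by
        intro i hi
        rw [Finset.mem_compl]
        intro hiD
        have := M.1.edgeSet_subset (mem_outerLegs.1 hi)
        rw [SimpleGraph.edgeSet_deleteEdges] at this
        exact this.2 ⟨i, hiD, rfl⟩
      have := Finset.card_le_card hsub
      rw [Finset.card_compl, Fintype.card_fin, hD] at this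
      omega
    · rw [SimpleGraph.edgeSet_deleteEdges, Set.ncard_sdiff hRsub (Set.toFinite _), hRcard]
    · rintro m ⟨H, hH, hfree, rfl⟩
      by_contra! hlt
      have hdiff := Set.ncard_sdiff (SimpleGraph.edgeSet_mono hH) (Set.toFinite _)
      obtain ⟨M⟩ := exists_rMatching_of_ncard_diff (s := s) (H := H) hkn (by omega)
      exact hfree.false M
  omega

end MatchingKneser

theorem theorem1 (r Θ Γ : ℕ) (hr : 3 ≤ r) (hΘ : 1 ≤ Θ) (hΓ : 1 ≤ Γ) (hΓr : Γ ≤ r - 2) :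
    ∃ (V : Type) (_ : Fintype V) (G : SimpleGraph V),
      G.Connected ∧ G.IsBipartite ∧
      (MatchingKneser.matchingKneserGraph G r).chromaticNumber = (Θ : ℕ∞) ∧
      (G.edgeSet.ncard : ℤ) - (MatchingKneser.exMatching G r : ℤ) = (Θ : ℤ) + (Γ : ℤ) := by
  -- The values `k = Γ + 1` and `n = Θ + 2Γ` solve `n - 2k + 2 = Θ` and `n - k + 1 = Θ + Γ`; the
  -- bound `Γ ≤ r - 2` is what leaves room for `s ≥ 0` stars.
  obtain ⟨s, rfl⟩ : ∃ s, r = s + (Γ + 1) + 1 := ⟨r - (Γ + 2), by omega⟩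
  obtain ⟨n, hn⟩ : ∃ n, n = Θ + 2 * Γ := ⟨_, rfl⟩
  refine ⟨MatchingKneser.SpiderVertex n s, Fintype.ofFinite _, MatchingKneser.spider n s,
    MatchingKneser.spider_connected, MatchingKneser.spider_isBipartite, le_antisymm ?_ ?_, ?_⟩
  · exact (MatchingKneser.matchingKneserGraph_spider_colorable hΘ (by omega)
      (by omega)).chromaticNumber_le
  · rw [SimpleGraph.le_chromaticNumber_iff_colorable]
    intro c hc
    have := MatchingKneser.le_of_matchingKneserGraph_spider_colorable (by omega) (by omega) hc
    omega
  · rw [MatchingKneser.ncard_sub_exMatching_spider (by omega) (by omega)]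
    omega
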